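/- Let $F:\mathbb{R}^d\to\mathbb{R}^d$ be $L$-Lipschitz ($L\ge 0$), let $G:\mathbb{R}^d\rightrightarrows\mathbb{R}^d$ be maximally monotone, let $\rho>0$, and let $x^*$ satisfy $0\in (F+G)(x^*)$ and the $\rho$-weak Minty variational inequality $\langle u,x-x^*\rangle\ge-\rho\|u\|^2$ for all $x\in\mathbb{R}^d$ and $u\in(F+G)(x)$. Let $\rho<\eta$ and $\eta L<1$, and write $J_A=(\mathrm{Id}+A)^{-1}$ for the resolvent of an operator $A$. For $x_0\in\mathbb{R}^d$ and $\alpha=1-\rho/\eta$ consider the inexact Krasnosel'skii-Mann iteration $$x_{k+1}=(1-\alpha)x_k+\alpha\, z^{(k)}_{N_k},\qquad N_k=\left\lceil\frac{4(1+\eta L)}{1-\eta L}\log\big(8(k+1)\log^2(k+2)\big)\right\rceil ,\qquad k\ge 0,$$ where $z^{(k)}_{N_k}$ is the result of $N_k$ steps of the forward-backward-forward method: with $\tau=\frac{1}{2(1+\eta L)}$ and $B_k(z)=z+\eta F(z)-x_k$, set $z^{(k)}_0=x_k$ and $$z^{(k)}_{t+1/2}=J_{\tau\eta G}\big(z^{(k)}_t-\tau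 B_k(z^{(k)}_t)\big),\qquad z^{(k)}_{t+1}=z^{(k)}_{t+1/2}+\tau B_k(z^{(k)}_t)-\tau B_k(z^{(k)}_{t+1/2}).$$ Let $\varepsilon>0$ and $K=\max\left\{1,\left\lceil\frac{11\|x_0-x^*\|^2}{(\eta-\rho)^2\varepsilon^2}\right\rceil\right\}$. Then for some $x^{\mathrm{out}}\in\{x_0,\dots,x_{K-1}\}$ the resolvent $J_{\eta(F+G)}$ is defined and single-valued at $x^{\mathrm{out}}$, and $$\eta^{-1}\|(\mathrm{Id}-J_{\eta(F+G)})(x^{\mathrm{out}})\|\le\varepsilon .$$ The total number of oracle calls (evaluations of $F$ and of the resolvent $J_{\tau\eta G}$) made in the first $K$ iterations is $$\widetilde O\left(\frac{(1+\eta L)\|x_0-x^*\|^2}{\varepsilon^2(\eta-\rho)^2(1-\eta L)}\right),$$ that is, with $\Lambda=\max\left\{1,\frac{\|x_0-x^*\|^2}{\varepsilon^2(\eta-\rho)^2}\right\}$, it is at most $C\,\frac{1+\eta L}{1-\eta L}\,\Lambda\,(1+\log\Lambda)$ for a universal constant $C$ (independent of $d,F,G,L,\eta,\rho,x_0,x^*,\varepsilon$).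 -/

import Mathlib

open scoped NNReal

noncomputable section

namespace WeakMVI

/-! ### Set-valued operators on a real inner product space -/

section Operators

variable {E : Type*} [NormedAddCommGroup E] [InnerProductSpace ℝ E]

/-- The set-valued operator `c A : x ↦ {c v : v ∈ A x}`. -/
def smulOp (c : ℝ) (A : E → Set E) : E → Set E :=
  fun x => {u | ∃ v ∈ A x, u = c • v}

/-- The set-valued operator `F + G : x ↦ {F x + v : v ∈ G x}`, with `F` single-valued. -/
def sumOp (F : E → E) (G : E → Set E) : E → Set E :=
  fun x => {u | ∃ v ∈ G x, u = F x + v}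

/-- Monotonicity of a set-valued operator. -/
def IsMonotoneOp (A : E → Set E) : Prop :=
  ∀ x y : E, ∀ u ∈ A x, ∀ v ∈ A y, 0 ≤ inner ℝ (u - v) (x - y)

/-- Maximal monotonicity: the graph is not strictly contained in the graph of another monotone
operator. -/
def IsMaximalMonotoneOp (A : E → Set E) : Prop :=
  IsMonotoneOp A ∧ ∀ B : E → Set E, IsMonotoneOp B → (∀ x, A x ⊆ B x) → B = A

/-- `xs` solves `0 ∈ (F + G)(xs)` and satisfies the `ρ`-weak Minty variational inequality
`⟨u, x - xs⟩ ≥ -ρ ‖u‖²` for every `(x, u)` in the graph of `F + G`. -/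
def IsWeakMVISolution (F : E → E) (G : E → Set E) (ρ : ℝ) (xs : E) : Prop :=
  (0 : E) ∈ sumOp F G xs ∧
    ∀ x : E, ∀ u ∈ sumOp F G x, inner ℝ u (x - xs) ≥ -ρ * ‖u‖ ^ 2

/-- The set-valued resolvent `J_A = (Id + A)⁻¹`: `y ∈ J_A x` iff `x ∈ y + A y`. -/
def resolventSet (A : E → Set E) (x : E) : Set E :=
  {y | ∃ u ∈ A y, x = y + u}

/-- The resolvent as a function: some element of `J_A x` (the only one when `A` is maximally
monotone); unspecified where `J_A x` is empty. -/
def resolvent (A : E → Set E) (x : E) : E :=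
  Classical.epsilon fun y => y ∈ resolventSet A x

end Operators

/-! ### Computations that count their oracle calls -/

/-- The result of a computation, with the number of oracle calls made by it. -/
structure Counted (α : Type*) where
  val : α
  calls : ℕ

namespace Counted

/-- A computation without oracle calls. -/
def pure {α : Type*} (a : α) : Counted α := ⟨a, 0⟩

/-- Sequential composition: the numbers of calls add up. -/
def bind {α β : Type*} (c : Counted α) (f : α → Counted β) : Counted β :=
  ⟨(f c.val).val, c.calls + (f c.val).calls⟩

/-- One call to the oracle `f` at the point `x`. -/
def query {α β : Type*} (f : α → β) (x : α) : Counted β := ⟨f x, 1⟩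

end Counted

/-! ### The algorithms -/

section Algorithms

variable {E : Type*} [NormedAddCommGroup E] [InnerProductSpace ℝ E]

/-- `N` steps of the forward-backward-forward method from `z₀` for `0 ∈ A z + B z`, where
`B z = Bin z - z₀`, with step size `τ`. The argument `evalB` evaluates `Bin`, and `resA` evaluates
`J_{τ A}`. In each step `Bin` is evaluated at `z_t` and at `z_{t+1/2}`, and `J_{τ A}` once. -/
def fbf (evalB resA : E → Counted E) (τ : ℝ) (z₀ : E) : ℕ → Counted E
  | 0 => Counted.pure z₀
  | t + 1 =>
    (fbf evalB resA τ z₀ t).bind fun z =>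
    (evalB z).bind fun b =>
    (resA (z - τ • (b - z₀))).bind fun zHalf =>
    (evalB zHalf).bind fun bHalf =>
    Counted.pure (zHalf + τ • (b - z₀) - τ • (bHalf - z₀))

/-- The number `N_k = ⌈4 (1 + η L) / (1 - η L) * log (8 (k + 1) log² (k + 2))⌉` of inner steps. -/
def innerSteps (η L : ℝ) (k : ℕ) : ℕ :=
  ⌈4 * (1 + η * L) / (1 - η * L) *
    Real.log (8 * ((k : ℝ) + 1) * Real.log ((k : ℝ) + 2) ^ 2)⌉₊

/-- The approximate resolvent `FBF (x, N, η G, Id + η F, 1 + η L)` of `η (F + G)` at `x`, with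
`τ = 1 / (2 (1 + η L))`. An evaluation of `Id + η F` is one call to `F`. -/
def approxResolvent (F : E → E) (G : E → Set E) (η L : ℝ) (N : ℕ) (x : E) : Counted E :=
  let τ : ℝ := 1 / (2 * (1 + η * L))
  fbf (fun z => (Counted.query F z).bind fun w => Counted.pure (z + η • w))
    (Counted.query (resolvent (smulOp τ (smulOp η G)))) τ x N

/-- The inexact Krasnoselskii-Mann iteration from `x₀`: after `k` iterations its value is the
iterate `x_k`, and its number of calls is the number of evaluations of `F` plus the number of
evaluations of resolvents of `G` made during these `k` iterations. Here `α = 1 - ρ / η`. -/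
def inexactKM (F : E → E) (G : E → Set E) (η L ρ : ℝ) (x₀ : E) : ℕ → Counted E
  | 0 => Counted.pure x₀
  | k + 1 =>
    (inexactKM F G η L ρ x₀ k).bind fun x =>
    (approxResolvent F G η L (innerSteps η L k) x).bind fun y =>
    Counted.pure ((1 - (1 - ρ / η)) • x + (1 - ρ / η) • y)

end Algorithms

end WeakMVI

end

/-!
Let `J` be the resolvent of `η (F + G)` and `α = 1 - ρ / η`. At the points `J x` the weak Minty
inequality says that the residual `r = α (x - J x)` satisfies `‖r‖² ≤ ⟨r, x - xs⟩`, so an exact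
Krasnoselskii-Mann step decreases `‖x - xs‖²` by at least `‖r‖²`. Since `Id + η F` is strongly
monotone and Lipschitz, each step of the forward-backward-forward method contracts the squared
distance to `J x` by the factor `1 - 3/7 (1 - η L) / (1 + η L)`, and after `N_k` steps the squared
error of the outer step is at most `‖r‖² / (5 (k + 1) ^ (3/2))`. These relative errors are summable,
so Grönwall's inequality gives `∑ ‖r_k‖² ≤ 11 ‖x₀ - xs‖²`, and the smallest of the first `K`
residuals is as small as claimed.

The resolvents are everywhere defined by Minty's theorem: `z` is the resolvent of a maximal monotone
`A` at `x` iff it lies, for every `(y, v)` in the graph of `A`, in the ball with diameter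
`[x - v, y]`. Finitely many of these balls have a common point by Sion's minimax theorem, and weak
compactness extends this to all of them.
-/

namespace WeakMVI

variable {E : Type*} [NormedAddCommGroup E]

theorem mem_resolventSet_iff {A : E → Set E} {x y : E} : y ∈ resolventSet A x ↔ x - y ∈ A y :=
  ⟨by rintro ⟨u, hu, rfl⟩; rwa [add_sub_cancel_left], fun h => ⟨x - y, h, by abel⟩⟩

theorem mem_resolventSet_sumOp_iff {A : E → Set E} {B : E → E} {x y : E} :
    y ∈ resolventSet (sumOp B A) x ↔ y ∈ resolventSet A (x - B y) := by
  refine ⟨?_, ?_⟩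
  · rintro ⟨_, ⟨u, hu, rfl⟩, rfl⟩
    exact ⟨u, hu, by abel⟩
  · rintro ⟨u, hu, h⟩
    exact ⟨B y + u, ⟨u, hu, rfl⟩, by rw [eq_add_of_sub_eq h]; abel⟩

variable [InnerProductSpace ℝ E]

/-! ### Minty's theorem -/

theorem inner_sub_sub_eq_dist_midpoint_sq_sub (a b z : E) :
    inner ℝ (z - a) (z - b) = dist z (midpoint ℝ a b) ^ 2 - (dist a b / 2) ^ 2 := by
  have two_smul_sub : (2 : ℝ) • (z - midpoint ℝ a b) = (z - a) + (z - b) := by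
    rw [midpoint_eq_smul_add, invOf_eq_inv]
    module
  have polarization : 4 * inner ℝ (z - a) (z - b) =
      ‖(2 : ℝ) • (z - midpoint ℝ a b)‖ ^ 2 - ‖a - b‖ ^ 2 := by
    rw [two_smul_sub, ← norm_sub_rev b a, ← sub_sub_sub_cancel_left a b z, norm_add_sq_real,
      norm_sub_sq_real (z - a) (z - b)]
    ring
  rw [norm_smul, Real.norm_ofNat] at polarization
  rw [dist_eq_norm, dist_eq_norm]
  linarith

theorem mem_closedBall_midpoint_iff_inner_nonpos {a b z : E} :
    z ∈ Metric.closedBall (midpoint ℝ a b) (dist a b / 2) ↔ inner ℝ (z - a) (z - b) ≤ 0 := by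
  rw [inner_sub_sub_eq_dist_midpoint_sq_sub, sub_nonpos, Metric.mem_closedBall]
  exact (pow_le_pow_iff_left₀ dist_nonneg (by positivity) two_ne_zero).symm

theorem convexOn_inner_sub_sub (a b : E) :
    ConvexOn ℝ Set.univ fun z : E => inner ℝ (z - a) (z - b) := by
  simp_rw [inner_sub_sub_eq_dist_midpoint_sq_sub, sub_eq_add_neg]
  exact ((convexOn_univ_dist _).pow (fun _ _ => dist_nonneg) 2).add_const _

theorem convexOn_sum_mul_inner_sub_sub {ι : Type*} [Fintype ι] {w : ι → ℝ} (hw : ∀ i, 0 ≤ w i)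
    (a b : ι → E) :
    ConvexOn ℝ Set.univ fun z : E => ∑ i, w i * inner ℝ (z - a i) (z - b i) := by
  have h := Finset.sum_induction (fun i (z : E) => w i * inner ℝ (z - a i) (z - b i))
    (ConvexOn ℝ Set.univ) (fun _ _ => ConvexOn.add) (convexOn_const 0 convex_univ)
    (s := Finset.univ) fun i _ => (convexOn_inner_sub_sub (a i) (b i)).smul (hw i)
  rwa [Finset.sum_fn] at h

theorem sum_mul_inner_barycenter_sub_nonpos {ι : Type*} [Fintype ι] {a b : ι → E}
    (hab : ∀ i j, inner ℝ (a i - a j) (b i - b j) ≤ 0) {w : ι → ℝ} (hw : w ∈ stdSimplex ℝ ι) :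
    ∑ i, w i * inner ℝ ((∑ j, w j • b j) - a i) ((∑ j, w j • b j) - b i) ≤ 0 := by
  set c := ∑ j, w j • b j with hc
  have sum_smul_sub (z : E) : ∑ j, w j • (b j - z) = c - z := by
    simp only [smul_sub, Finset.sum_sub_distrib, ← Finset.sum_smul, hw.2, one_smul, hc]
  have inner_c : ∑ i, w i * inner ℝ c (c - b i) = 0 := by
    have : ∑ i, w i * inner ℝ c (c - b i) = -inner ℝ c (∑ i, w i • (b i - c)) := by
      simp only [inner_sum, real_inner_smul_right, inner_sub_right, ← Finset.sum_neg_distrib]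
      exact Finset.sum_congr rfl fun i _ => by ring
    rw [this, sum_smul_sub, sub_self, inner_zero_right, neg_zero]
  have inner_a : ∑ i, w i * inner ℝ (a i) (c - b i) =
      ∑ i, ∑ j, w i * w j * inner ℝ (a i) (b j - b i) := by
    simp_rw [← sum_smul_sub, inner_sum, real_inner_smul_right, Finset.mul_sum, mul_assoc]
  have swap : ∑ i, ∑ j, w i * w j * inner ℝ (a i) (b j - b i) =
      ∑ i, ∑ j, w i * w j * inner ℝ (a j) (b i - b j) := by
    rw [Finset.sum_comm]
    simp_rw [mul_comm (w _) (w _)]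
  have symmetrized : 0 ≤ ∑ i, ∑ j, w i * w j * inner ℝ (a i) (b j - b i) +
      ∑ i, ∑ j, w i * w j * inner ℝ (a j) (b i - b j) := by
    simp_rw [← Finset.sum_add_distrib]
    refine Finset.sum_nonneg fun i _ => Finset.sum_nonneg fun j _ => ?_
    have := mul_nonpos_of_nonneg_of_nonpos (mul_nonneg (hw.1 i) (hw.1 j)) (hab i j)
    simp only [inner_sub_left, inner_sub_right] at this ⊢
    linarith
  simp_rw [inner_sub_left _ (a _), mul_sub, Finset.sum_sub_distrib]
  linarith

/-- Sion's minimax theorem is applied to `∑ i, w i * ⟨z - a i, z - b i⟩`, `w` in the simplex. -/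
theorem exists_forall_inner_sub_sub_nonpos_of_finite {ι : Type*} [Finite ι] {a b : ι → E}
    (hab : ∀ i j, inner ℝ (a i - a j) (b i - b j) ≤ 0) :
    ∃ z : E, ∀ i, inner ℝ (z - a i) (z - b i) ≤ 0 := by
  classical
  cases nonempty_fintype ι
  rcases isEmpty_or_nonempty ι with hι | ⟨⟨i₀⟩⟩
  · exact ⟨0, hι.elim⟩
  let f : E → (ι → ℝ) → ℝ := fun z w => ∑ i, w i * inner ℝ (z - a i) (z - b i)
  have f_single (z : E) (i : ι) : f z (Pi.single i 1) = inner ℝ (z - a i) (z - b i) := by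
    simp [f, Pi.single_apply]
  have f_concave (z : E) : ConcaveOn ℝ (stdSimplex ℝ ι) (f z) :=
    ⟨convex_stdSimplex ℝ ι, fun w _ w' _ s t _ _ _ => le_of_eq <| by
      simp only [f, Pi.add_apply, Pi.smul_apply, smul_eq_mul, add_mul, Finset.sum_add_distrib,
        Finset.mul_sum, mul_assoc]⟩
  obtain ⟨z, -, w, hw, hzw⟩ := Sion.exists_isSaddlePointOn
    (X := convexHull ℝ (Set.range b)) (Y := stdSimplex ℝ ι) (f := f)
    ⟨b i₀, subset_convexHull ℝ _ ⟨i₀, rfl⟩⟩ (convex_convexHull ℝ _)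
    ((Set.finite_range b).isCompact_convexHull ℝ)
    (fun w _ => (by fun_prop : Continuous (f · w)).lowerSemicontinuous.lowerSemicontinuousOn _)
    (fun w hw => ((convexOn_sum_mul_inner_sub_sub hw.1 a b).subset (Set.subset_univ _)
      (convex_convexHull ℝ _)).quasiconvexOn)
    (convex_stdSimplex ℝ ι) ⟨_, single_mem_stdSimplex ℝ i₀⟩ (isCompact_stdSimplex ℝ ι)
    (fun z _ => (by fun_prop : Continuous (f z)).upperSemicontinuous.upperSemicontinuousOn _)
    (fun z _ => (f_concave z).quasiconcaveOn)
  have barycenter_mem : ∑ j, w j • b j ∈ convexHull ℝ (Set.range b) :=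
    (convex_convexHull ℝ _).sum_mem (fun j _ => hw.1 j) hw.2
      fun j _ => subset_convexHull ℝ _ ⟨j, rfl⟩
  refine ⟨z, fun i => ?_⟩
  calc inner ℝ (z - a i) (z - b i) = f z (Pi.single i 1) := (f_single z i).symm
    _ ≤ f (∑ j, w j • b j) w := hzw _ barycenter_mem _ (single_mem_stdSimplex ℝ i)
    _ ≤ 0 := sum_mul_inner_barycenter_sub_nonpos hab hw

/-- Under the Riesz isometry closed balls become weak-* compact. -/
theorem nonempty_iInter_closedBall [CompleteSpace E] {ι : Type*} {c : ι → E} {r : ι → ℝ}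
    (h : ∀ u : Finset ι, (⋂ i ∈ u, Metric.closedBall (c i) (r i)).Nonempty) :
    (⋂ i, Metric.closedBall (c i) (r i)).Nonempty := by
  classical
  rcases isEmpty_or_nonempty ι with hι | ⟨⟨i₀⟩⟩
  · simp
  let toDual := InnerProductSpace.toDual ℝ E
  let t : ι → Set (WeakDual ℝ E) := fun i =>
    WeakDual.toStrongDual ⁻¹' Metric.closedBall (toDual (c i)) (r i)
  have mem_t (z : E) (i : ι) :
      StrongDual.toWeakDual (toDual z) ∈ t i ↔ z ∈ Metric.closedBall (c i) (r i) := by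
    simp [t]
  have isCompact_t : IsCompact (t i₀) := WeakDual.isCompact_closedBall _ _
  obtain ⟨φ, -, hφ⟩ := isCompact_t.inter_iInter_nonempty t
    (fun i => WeakDual.isClosed_closedBall _ _) fun u => by
      obtain ⟨z, hz⟩ := h (insert i₀ u)
      simp only [Finset.mem_insert, Set.mem_iInter] at hz
      exact ⟨StrongDual.toWeakDual (toDual z), (mem_t z i₀).2 (hz i₀ (.inl rfl)),
        Set.mem_iInter₂.2 fun i hi => (mem_t z i).2 (hz i (.inr hi))⟩
  obtain ⟨z, hz⟩ := toDual.surjective (WeakDual.toStrongDual φ)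
  refine ⟨z, Set.mem_iInter.2 fun i => (mem_t z i).1 ?_⟩
  rw [hz]
  exact Set.mem_iInter.1 hφ i

theorem exists_forall_inner_sub_sub_nonpos [CompleteSpace E] {ι : Type*} {a b : ι → E}
    (hab : ∀ i j, inner ℝ (a i - a j) (b i - b j) ≤ 0) :
    ∃ z : E, ∀ i, inner ℝ (z - a i) (z - b i) ≤ 0 := by
  simp_rw [← mem_closedBall_midpoint_iff_inner_nonpos, ← Set.mem_iInter]
  refine nonempty_iInter_closedBall fun u => ?_
  obtain ⟨z, hz⟩ := exists_forall_inner_sub_sub_nonpos_of_finite fun i j : u => hab i j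
  exact ⟨z, Set.mem_iInter₂.2 fun i hi =>
    mem_closedBall_midpoint_iff_inner_nonpos.2 (hz ⟨i, hi⟩)⟩

theorem IsMaximalMonotoneOp.mem_of_forall_inner_nonneg {A : E → Set E}
    (hA : IsMaximalMonotoneOp A) {x u : E} (h : ∀ y, ∀ v ∈ A y, 0 ≤ inner ℝ (u - v) (x - y)) :
    u ∈ A x := by
  have hB := hA.2 (fun y => A y ∪ {v | y = x ∧ v = u}) ?_ fun y => Set.subset_union_left
  · rw [← hB]
    exact Or.inr ⟨rfl, rfl⟩
  · rintro y z v (hv | ⟨rfl, rfl⟩) w (hw | ⟨rfl, rfl⟩)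
    · exact hA.1 y z v hv w hw
    · rw [← inner_neg_neg, neg_sub, neg_sub]
      exact h y v hv
    · exact h z w hw
    · simp

theorem IsMaximalMonotoneOp.nonempty_resolventSet [CompleteSpace E] {A : E → Set E}
    (hA : IsMaximalMonotoneOp A) (x : E) : (resolventSet A x).Nonempty := by
  obtain ⟨z, hz⟩ := exists_forall_inner_sub_sub_nonpos
    (a := fun p : {p : E × E // p.2 ∈ A p.1} => x - p.1.2) (b := fun p => p.1.1) fun p q => by
      rw [sub_sub_sub_cancel_left, ← neg_sub, inner_neg_left, neg_nonpos]
      exact hA.1 _ _ _ p.2 _ q.2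
  refine ⟨z, mem_resolventSet_iff.2 (hA.mem_of_forall_inner_nonneg fun y v hv => ?_)⟩
  have h := hz ⟨(y, v), hv⟩
  rwa [← neg_nonneg, ← inner_neg_left, neg_sub, sub_right_comm] at h

/-! ### Resolvents of monotone operators -/

theorem IsMonotoneOp.smulOp {A : E → Set E} (hA : IsMonotoneOp A) {c : ℝ} (hc : 0 ≤ c) :
    IsMonotoneOp (smulOp c A) := by
  rintro x y _ ⟨u, hu, rfl⟩ _ ⟨v, hv, rfl⟩
  rw [← smul_sub, real_inner_smul_left]
  exact mul_nonneg hc (hA x y u hu v hv)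

theorem IsMaximalMonotoneOp.smulOp {A : E → Set E} (hA : IsMaximalMonotoneOp A) {c : ℝ}
    (hc : 0 < c) : IsMaximalMonotoneOp (smulOp c A) := by
  refine ⟨hA.1.smulOp hc.le, fun B hB hAB => ?_⟩
  have h := hA.2 (WeakMVI.smulOp c⁻¹ B) (hB.smulOp (inv_nonneg.2 hc.le)) fun x u hu =>
    ⟨c • u, hAB x ⟨u, hu, rfl⟩, (inv_smul_smul₀ hc.ne' u).symm⟩
  refine funext fun x => Set.Subset.antisymm (fun u hu => ?_) (hAB x)
  refine ⟨c⁻¹ • u, ?_, (smul_inv_smul₀ hc.ne' u).symm⟩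
  rw [← h]
  exact ⟨u, hu, rfl⟩

theorem smulOp_sumOp (c : ℝ) (F : E → E) (G : E → Set E) :
    smulOp c (sumOp F G) = sumOp (fun x => c • F x) (smulOp c G) := by
  ext x u
  constructor
  · rintro ⟨_, ⟨v, hv, rfl⟩, rfl⟩
    exact ⟨c • v, ⟨v, hv, rfl⟩, smul_add c _ _⟩
  · rintro ⟨_, ⟨v, hv, rfl⟩, rfl⟩
    exact ⟨F x + v, ⟨v, hv, rfl⟩, (smul_add c _ _).symm⟩

theorem IsMaximalMonotoneOp.resolvent_mem [CompleteSpace E] {A : E → Set E}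
    (hA : IsMaximalMonotoneOp A) (x : E) : resolvent A x ∈ resolventSet A x :=
  Classical.epsilon_spec (hA.nonempty_resolventSet x)

theorem IsMonotoneOp.norm_sub_le_of_mem_resolventSet {A : E → Set E} (hA : IsMonotoneOp A)
    {x x' y y' : E} (hy : y ∈ resolventSet A x) (hy' : y' ∈ resolventSet A x') :
    ‖y - y'‖ ≤ ‖x - x'‖ := by
  obtain ⟨u, hu, rfl⟩ := hy
  obtain ⟨u', hu', rfl⟩ := hy'
  have h := hA y y' u hu u' hu'
  refine le_of_sq_le_sq ?_ (norm_nonneg _)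
  rw [add_sub_add_comm, norm_add_sq_real, real_inner_comm]
  linarith [sq_nonneg ‖u - u'‖]

theorem exists_resolventSet_sumOp_eq_singleton [CompleteSpace E] {A : E → Set E} {B : E → E}
    {κ : ℝ≥0} (hA : IsMaximalMonotoneOp A) (hB : LipschitzWith κ B) (hκ : κ < 1) (x : E) :
    ∃ p, resolventSet (sumOp B A) x = {p} := by
  let T : E → E := fun z => resolvent A (x - B z)
  have hT : ContractingWith κ T := by
    refine ⟨hκ, LipschitzWith.of_dist_le_mul fun z w => ?_⟩
    calc dist (T z) (T w) ≤ ‖x - B z - (x - B w)‖ := by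
          rw [dist_eq_norm]
          exact hA.1.norm_sub_le_of_mem_resolventSet (hA.resolvent_mem _) (hA.resolvent_mem _)
      _ = dist (B z) (B w) := by rw [sub_sub_sub_cancel_left, ← norm_sub_rev, dist_eq_norm]
      _ ≤ κ * dist z w := hB.dist_le_mul z w
  refine ⟨hT.fixedPoint T, Set.eq_singleton_iff_unique_mem.2 ⟨?_, fun z hz => ?_⟩⟩
  · have h := hA.resolvent_mem (x - B (hT.fixedPoint T))
    rw [show resolvent A _ = hT.fixedPoint T from hT.fixedPoint_isFixedPt] at h
    exact mem_resolventSet_sumOp_iff.2 h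
  · refine hT.fixedPoint_unique ?_
    have h := hA.1.norm_sub_le_of_mem_resolventSet (hA.resolvent_mem (x - B z))
      (mem_resolventSet_sumOp_iff.1 hz)
    rwa [sub_self, norm_zero, norm_le_zero_iff, sub_eq_zero] at h

/-! ### The forward-backward-forward method -/

/-- Strong monotonicity, with modulus `μ`, of a single-valued operator. It drives the linear
convergence of the forward-backward-forward method. -/
def IsStronglyMonotone (μ : ℝ) (B : E → E) : Prop :=
  ∀ x y, μ * ‖x - y‖ ^ 2 ≤ inner ℝ (B x - B y) (x - y)

theorem isStronglyMonotone_id_add {κ : ℝ≥0} {B : E → E} (hB : LipschitzWith κ B) :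
    IsStronglyMonotone (1 - κ) fun z => z + B z := fun x y => by
  have cauchy_schwarz : -(‖B x - B y‖ * ‖x - y‖) ≤ inner ℝ (B x - B y) (x - y) :=
    neg_le_of_abs_le (abs_real_inner_le_norm _ _)
  have lipschitz := mul_le_mul_of_nonneg_right (hB.norm_sub_le x y) (norm_nonneg (x - y))
  rw [add_sub_add_comm, inner_add_left, real_inner_self_eq_norm_sq]
  linarith

theorem norm_add_sq_le_seven_thirds_mul (u w : E) :
    ‖u + w‖ ^ 2 ≤ 7 / 3 * (3 / 4 * ‖u‖ ^ 2 + ‖w‖ ^ 2) := by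
  have h := sq_nonneg ‖(3 : ℝ) • u - (4 : ℝ) • w‖
  rw [norm_sub_sq_real, norm_smul, norm_smul, real_inner_smul_left, real_inner_smul_right,
    Real.norm_ofNat, Real.norm_ofNat] at h
  rw [norm_add_sq_real]
  linarith

/-- One step of the method, with `u = z - z'`, `w = z' - p` and `w + d = z'' - p` for the current
point `z`, the midpoint `z'`, the next point `z''` and the solution `p`. -/
theorem norm_add_sq_le_of_mul_norm_sq_le_inner {u w d : E} {κ : ℝ} (hκ₀ : 0 ≤ κ) (hκ₁ : κ ≤ 1)
    (hd : ‖d‖ ≤ ‖u‖ / 2) (h : κ / 2 * ‖w‖ ^ 2 ≤ inner ℝ w (u - d)) :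
    ‖w + d‖ ^ 2 ≤ (1 - 3 / 7 * κ) * ‖u + w‖ ^ 2 := by
  have norm_d_sq : ‖d‖ ^ 2 ≤ (‖u‖ / 2) ^ 2 := by gcongr
  have descent : ‖w + d‖ ^ 2 ≤ ‖u + w‖ ^ 2 - 3 / 4 * ‖u‖ ^ 2 - κ * ‖w‖ ^ 2 := by
    rw [inner_sub_right, real_inner_comm u w] at h
    rw [norm_add_sq_real, norm_add_sq_real]
    linarith
  have u_sq : κ * ‖u‖ ^ 2 ≤ ‖u‖ ^ 2 := mul_le_of_le_one_left (sq_nonneg _) hκ₁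
  have young := mul_le_mul_of_nonneg_left (norm_add_sq_le_seven_thirds_mul u w) hκ₀
  linarith

theorem norm_fbf_step_sub_sq_le {A : E → Set E} {B : E → E} {ℓ : ℝ≥0} {μ : ℝ}
    (hA : IsMonotoneOp A) (hB : LipschitzWith ℓ B) (hBμ : IsStronglyMonotone μ B) (hμ : 0 ≤ μ)
    (hμℓ : μ ≤ ℓ) (hℓ : 0 < ℓ) {τ : ℝ} (hτ : τ = 1 / (2 * ℓ)) {z z' p : E}
    (hz' : z' ∈ resolventSet (smulOp τ A) (z - τ • B z)) (hp : 0 ∈ sumOp B A p) :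
    ‖z' + τ • B z - τ • B z' - p‖ ^ 2 ≤ (1 - 3 / 7 * (μ / ℓ)) * ‖z - p‖ ^ 2 := by
  have hτ₀ : 0 ≤ τ := by rw [hτ]; positivity
  obtain ⟨_, ⟨a, ha, rfl⟩, hz'a⟩ := hz'
  obtain ⟨a', ha', hpa'⟩ := hp
  have correction_le : ‖τ • (B z - B z')‖ ≤ ‖z - z'‖ / 2 := by
    rw [norm_smul, Real.norm_of_nonneg hτ₀]
    calc τ * ‖B z - B z'‖ ≤ τ * (ℓ * ‖z - z'‖) := by gcongr; exact hB.norm_sub_le z z'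
      _ = ‖z - z'‖ / 2 := by rw [hτ]; field_simp
  have forward : (z - z') - τ • (B z - B z') = τ • ((a - a') + (B z' - B p)) := by
    rw [show (a - a') + (B z' - B p) = a + B z' - (B p + a') by abel, ← hpa', sub_zero, smul_add,
      smul_sub, eq_sub_of_add_eq' hz'a.symm]
    abel
  have inner_ge : μ / ℓ / 2 * ‖z' - p‖ ^ 2 ≤ inner ℝ (z' - p) ((z - z') - τ • (B z - B z')) := by
    rw [forward, real_inner_smul_right, inner_add_right, real_inner_comm,
      real_inner_comm (B z' - _)]
    calc μ / ℓ / 2 * ‖z' - p‖ ^ 2 = τ * (0 + μ * ‖z' - p‖ ^ 2) := by rw [hτ]; field_simp; simp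
      _ ≤ _ := by gcongr; exacts [hA z' p a ha a' ha', hBμ z' p]
  have key := norm_add_sq_le_of_mul_norm_sq_le_inner (by positivity)
    ((div_le_one (by positivity)).2 hμℓ) correction_le inner_ge
  rwa [sub_add_sub_cancel, smul_sub, sub_add_sub_comm, add_comm p, ← sub_sub] at key

theorem norm_fbf_sub_sq_le {A : E → Set E} {evalB resA : E → Counted E} {ℓ : ℝ≥0} {μ τ : ℝ}
    (hA : IsMonotoneOp A) (hB : LipschitzWith ℓ fun z => (evalB z).val)
    (hBμ : IsStronglyMonotone μ fun z => (evalB z).val) (hμ : 0 ≤ μ) (hμℓ : μ ≤ ℓ) (hℓ : 0 < ℓ)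
    (hτ : τ = 1 / (2 * ℓ)) (hresA : ∀ z, (resA z).val ∈ resolventSet (smulOp τ A) z) {z₀ p : E}
    (hp : z₀ ∈ sumOp (fun z => (evalB z).val) A p) (N : ℕ) :
    ‖(fbf evalB resA τ z₀ N).val - p‖ ^ 2 ≤ (1 - 3 / 7 * (μ / ℓ)) ^ N * ‖z₀ - p‖ ^ 2 := by
  have rate_nonneg : 0 ≤ 1 - 3 / 7 * (μ / ℓ) := by
    linarith [(div_le_one (by positivity : (0 : ℝ) < ℓ)).2 hμℓ]
  let B : E → E := fun z => (evalB z).val - z₀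
  have B_lipschitz : LipschitzWith ℓ B := by simpa using hB.sub (.const z₀)
  have B_stronglyMonotone : IsStronglyMonotone μ B := fun x y => by
    simpa only [B, sub_sub_sub_cancel_right] using hBμ x y
  have zero_mem : 0 ∈ sumOp B A p := by
    obtain ⟨a, ha, hpa⟩ := hp
    exact ⟨a, ha, by simp only [B]; rw [hpa]; abel⟩
  induction N with
  | zero => rw [pow_zero, one_mul, fbf, Counted.pure]
  | succ N ih =>
    refine (norm_fbf_step_sub_sq_le hA B_lipschitz B_stronglyMonotone hμ hμℓ hℓ hτ (hresA _)
      zero_mem).trans ?_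
    rw [pow_succ' (1 - _), mul_assoc]
    exact mul_le_mul_of_nonneg_left ih rate_nonneg

theorem norm_approxResolvent_sub_sq_le [CompleteSpace E] {F : E → E} {G : E → Set E} {L : ℝ≥0}
    {η : ℝ} (hF : LipschitzWith L F) (hG : IsMaximalMonotoneOp G) (hη : 0 < η) (hηL : η * L < 1)
    {x p : E} (hp : p ∈ resolventSet (smulOp η (sumOp F G)) x) (N : ℕ) :
    ‖(approxResolvent F G η L N x).val - p‖ ^ 2 ≤
      (1 - 3 / 7 * ((1 - η * L) / (1 + η * L))) ^ N * ‖x - p‖ ^ 2 := by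
  lift η to ℝ≥0 using hη.le
  have smul_lipschitz : LipschitzWith (η * L) fun z => (η : ℝ) • F z := by
    simpa [Function.comp_def] using (lipschitzWith_smul (η : ℝ)).comp hF
  have hℓ : ((1 + η * L : ℝ≥0) : ℝ) = 1 + η * L := by push_cast; rfl
  have hμ : 1 - ((η * L : ℝ≥0) : ℝ) = 1 - η * L := by push_cast; rfl
  have hηG := hG.smulOp hη
  have hτ : 0 < 1 / (2 * (1 + (η : ℝ) * L)) := by positivity
  rw [← hℓ, ← hμ]
  refine norm_fbf_sub_sq_le hηG.1 (LipschitzWith.id.add smul_lipschitz)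
    (isStronglyMonotone_id_add smul_lipschitz) ?_ ?_ (by positivity) (by rw [hℓ])
    (hηG.smulOp hτ).resolvent_mem ?_ N
  · rw [hμ]; linarith
  · rw [hμ, hℓ]; linarith [show 0 ≤ (η : ℝ) * L by positivity]
  · rw [smulOp_sumOp] at hp
    obtain ⟨_, ⟨g, hg, rfl⟩, rfl⟩ := hp
    exact ⟨g, hg, (add_assoc _ _ _).symm⟩

theorem calls_approxResolvent (F : E → E) (G : E → Set E) (η L : ℝ) (N : ℕ) (x : E) :
    (approxResolvent F G η L N x).calls = 3 * N := by
  induction N with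
  | zero => rfl
  | succ N ih =>
    simp only [approxResolvent, fbf, Counted.bind, Counted.query, Counted.pure] at ih ⊢
    lia

/-! ### The number of inner steps -/

theorem three_mul_le_eight_mul_mul_log_sq (k : ℕ) :
    3 * ((k : ℝ) + 1) ≤ 8 * ((k : ℝ) + 1) * Real.log ((k : ℝ) + 2) ^ 2 := by
  have log_two_le : Real.log 2 ≤ Real.log ((k : ℝ) + 2) :=
    Real.log_le_log two_pos (le_add_of_nonneg_left k.cast_nonneg)
  have log_sq_ge : 3 / 8 ≤ Real.log ((k : ℝ) + 2) ^ 2 := by nlinarith [Real.log_two_gt_d9]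
  calc 3 * ((k : ℝ) + 1) = 8 * ((k : ℝ) + 1) * (3 / 8) := by ring
    _ ≤ _ := by gcongr

theorem five_mul_sqrt_pow_three_le {x y : ℝ} (hxy : 3 * x ≤ y) : 5 * √x ^ 3 ≤ √y ^ 3 := by
  have five_le : 5 ≤ √3 ^ 3 := by
    have : (5 / 3 : ℝ) ≤ √3 := Real.le_sqrt_of_sq_le (by norm_num)
    rw [pow_succ, Real.sq_sqrt zero_le_three]
    linarith
  calc 5 * √x ^ 3 ≤ √3 ^ 3 * √x ^ 3 := by gcongr
    _ = √(3 * x) ^ 3 := by rw [Real.sqrt_mul zero_le_three, mul_pow]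
    _ ≤ √y ^ 3 := by gcongr

theorem four_mul_log_le_mul_innerSteps {η L : ℝ} (h₀ : 0 ≤ η * L) (h₁ : η * L < 1) (k : ℕ) :
    4 * Real.log (8 * ((k : ℝ) + 1) * Real.log ((k : ℝ) + 2) ^ 2) ≤
      (1 - η * L) / (1 + η * L) * innerSteps η L k := by
  have hμ : 0 < 1 - η * L := by linarith
  have hℓ : 0 < 1 + η * L := by linarith
  rw [← mul_inv_le_iff₀' (div_pos hμ hℓ), inv_div]
  refine le_trans (le_of_eq ?_) (Nat.le_ceil _)
  ring

theorem pow_innerSteps_le {η L : ℝ} (h₀ : 0 ≤ η * L) (h₁ : η * L < 1) (k : ℕ) :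
    (1 - 3 / 7 * ((1 - η * L) / (1 + η * L))) ^ innerSteps η L k ≤
      1 / (5 * √((k : ℝ) + 1) ^ 3) := by
  have steps_ge := four_mul_log_le_mul_innerSteps h₀ h₁ k
  have hY := three_mul_le_eight_mul_mul_log_sq k
  set κ := (1 - η * L) / (1 + η * L)
  set Y := 8 * ((k : ℝ) + 1) * Real.log ((k : ℝ) + 2) ^ 2
  have κ_le_one : κ ≤ 1 := (div_le_one (by linarith)).2 (by linarith)
  have one_le_Y : 1 ≤ Y := by linarith [k.cast_nonneg (α := ℝ)]
  calc (1 - 3 / 7 * κ) ^ innerSteps η L k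
      ≤ Real.exp (-(3 / 7 * κ)) ^ innerSteps η L k :=
        pow_le_pow_left₀ (by linarith) (Real.one_sub_le_exp_neg _) _
    _ = Real.exp (-(3 / 7 * (κ * innerSteps η L k))) := by rw [← Real.exp_nat_mul]; ring_nf
    _ ≤ Real.exp (-((3 : ℕ) * Real.log √Y)) := by
        rw [Real.log_sqrt (by linarith), Real.exp_le_exp, Nat.cast_ofNat]
        linarith [Real.log_nonneg one_le_Y]
    _ = 1 / √Y ^ 3 := by
        rw [Real.exp_neg, Real.exp_nat_mul, Real.exp_log (by positivity), one_div]
    _ ≤ 1 / (5 * √((k : ℝ) + 1) ^ 3) := by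
        gcongr
        exact five_mul_sqrt_pow_three_le hY

theorem one_div_pow_three_le_two_div_sub_two_div {a b : ℝ} (ha : 0 < a) (hb : 0 < b)
    (hab : b ^ 2 - a ^ 2 = 1) : 1 / b ^ 3 ≤ 2 / a - 2 / b := by
  have a_le_b : a ≤ b := le_of_sq_le_sq (by linarith) hb.le
  calc 1 / b ^ 3 = 2 / (b * b * (b + b)) := by field_simp; norm_num
    _ ≤ 2 / (a * b * (a + b)) := by gcongr
    _ = 2 / a - 2 / b := by field_simp; linarith

theorem sum_one_div_sqrt_pow_three_le (n : ℕ) :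
    ∑ k ∈ Finset.range n, 1 / √((k : ℝ) + 1) ^ 3 ≤ 3 := by
  cases n with
  | zero => simp
  | succ n =>
    have term_le (k : ℕ) : 1 / √((k + 1 : ℕ) + 1 : ℝ) ^ 3 ≤
        2 / √((k : ℝ) + 1) - 2 / √((k + 1 : ℕ) + 1 : ℝ) :=
      one_div_pow_three_le_two_div_sub_two_div (by positivity) (by positivity) (by
        rw [Real.sq_sqrt (by positivity), Real.sq_sqrt (by positivity)]; push_cast; ring)
    have telescope := Finset.sum_range_sub' (fun k : ℕ => 2 / √((k : ℝ) + 1)) n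
    have sum_le := Finset.sum_le_sum fun k (_ : k ∈ Finset.range n) => term_le k
    rw [telescope, Nat.cast_zero, zero_add, Real.sqrt_one] at sum_le
    rw [Finset.sum_range_succ', Nat.cast_zero, zero_add, Real.sqrt_one]
    linarith [show 0 ≤ 2 / √((n : ℝ) + 1) by positivity]

/-! ### The Krasnoselskii-Mann iteration -/

theorem norm_sub_add_sq_le {v r e : E} {q : ℝ} (hr : ‖r‖ ^ 2 ≤ inner ℝ r v)
    (hq : 0 < q) (he : ‖e‖ ^ 2 ≤ q * ‖r‖ ^ 2) :
    ‖v - r + e‖ ^ 2 ≤ (1 + 2 * q) * ‖v‖ ^ 2 - ‖r‖ ^ 2 / 2 := by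
  have exact_step : ‖v - r‖ ^ 2 ≤ ‖v‖ ^ 2 - ‖r‖ ^ 2 := by
    rw [norm_sub_sq_real, real_inner_comm]
    linarith
  have young : 2 * inner ℝ (v - r) e ≤ 2 * q * ‖v - r‖ ^ 2 + ‖e‖ ^ 2 / (2 * q) := by
    have h := div_nonneg (sq_nonneg ‖(2 * q) • (v - r) - e‖) (by positivity : 0 ≤ 2 * q)
    rw [norm_sub_sq_real, norm_smul, real_inner_smul_left, Real.norm_of_nonneg (by positivity),
      mul_pow, sq (2 * q), add_div, sub_div, mul_assoc, mul_div_cancel_left₀ _ (by positivity),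
      mul_left_comm, mul_div_cancel_left₀ _ (by positivity)] at h
    linarith
  have error_le : ‖e‖ ^ 2 / (2 * q) ≤ ‖r‖ ^ 2 / 2 := by
    rw [div_le_iff₀ (by positivity)]
    linarith
  have scaled := mul_le_mul_of_nonneg_left exact_step (by linarith : 0 ≤ 1 + 2 * q)
  rw [norm_add_sq_real]
  linarith [mul_nonneg hq.le (sq_nonneg ‖r‖)]

theorem sum_norm_sq_le_of_inexact_step {x r e : ℕ → E} {xs : E} {q : ℕ → ℝ}
    (hx : ∀ k, x (k + 1) = x k - r k + e k) (hr : ∀ k, ‖r k‖ ^ 2 ≤ inner ℝ (r k) (x k - xs))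
    (hq : ∀ k, 0 < q k) (he : ∀ k, ‖e k‖ ^ 2 ≤ q k * ‖r k‖ ^ 2) (n : ℕ) :
    ∑ k ∈ Finset.range n, ‖r k‖ ^ 2 ≤
      2 * Real.exp (2 * ∑ k ∈ Finset.range n, q k) * ‖x 0 - xs‖ ^ 2 := by
  let u : ℕ → ℝ := fun n => ‖x n - xs‖ ^ 2 + (∑ k ∈ Finset.range n, ‖r k‖ ^ 2) / 2
  have u_succ_le (n : ℕ) : u (n + 1) ≤ (1 + 2 * q n) * u n + 0 := by
    have step := norm_sub_add_sq_le (hr n) (hq n) (he n)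
    rw [sub_right_comm, sub_add_eq_add_sub, ← hx] at step
    have past_nonneg : 0 ≤ q n * ∑ k ∈ Finset.range n, ‖r k‖ ^ 2 :=
      mul_nonneg (hq n).le (Finset.sum_nonneg fun k _ => sq_nonneg _)
    simp only [u, Finset.sum_range_succ]
    linarith
  have gronwall := discrete_gronwall (n₀ := 0) (by positivity) (fun n _ => u_succ_le n)
    (fun n _ => by linarith [hq n]) (fun _ _ => le_rfl) n.zero_le
  simp only [u, Finset.sum_const_zero, Finset.range_zero, Finset.sum_empty, zero_div, add_zero,
    Nat.Ico_zero_eq_range, ← Finset.mul_sum] at gronwall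
  linarith [sq_nonneg ‖x n - xs‖]

theorem IsWeakMVISolution.mul_norm_sq_le_inner {F : E → E} {G : E → Set E} {η ρ : ℝ} {xs x p : E}
    (hxs : IsWeakMVISolution F G ρ xs) (hη : 0 < η)
    (hp : p ∈ resolventSet (smulOp η (sumOp F G)) x) :
    (1 - ρ / η) * ‖x - p‖ ^ 2 ≤ inner ℝ (x - p) (x - xs) := by
  obtain ⟨_, ⟨u, hu, rfl⟩, rfl⟩ := hp
  have weak_minty := mul_le_mul_of_nonneg_left (hxs.2 p u hu) hη.le
  rw [add_sub_cancel_left, show p + η • u - xs = η • u + (p - xs) by abel, inner_add_right,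
    real_inner_self_eq_norm_sq, real_inner_smul_left, norm_smul, Real.norm_of_nonneg hη.le]
  have expand : (1 - ρ / η) * (η * ‖u‖) ^ 2 = (η * ‖u‖) ^ 2 + η * (-ρ * ‖u‖ ^ 2) := by
    field_simp
    ring
  linarith

theorem exp_six_fifths_le : Real.exp (6 / 5) ≤ 11 / 2 := by
  have exp_two_fifths_le : Real.exp (2 / 5) ≤ 1 / (1 - 2 / 5) :=
    Real.exp_bound_div_one_sub_of_interval (by norm_num) (by norm_num)
  calc Real.exp (6 / 5) = Real.exp (2 / 5) ^ 3 := by rw [← Real.exp_nat_mul]; norm_num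
    _ ≤ (1 / (1 - 2 / 5)) ^ 3 := by gcongr
    _ ≤ 11 / 2 := by norm_num

section InexactKM

variable [CompleteSpace E] {F : E → E} {G : E → Set E} {L : ℝ≥0} {η ρ : ℝ} {xs : E}

theorem exists_resolventSet_smulOp_sumOp_eq_singleton (hF : LipschitzWith L F)
    (hG : IsMaximalMonotoneOp G) (hη : 0 < η) (hηL : η * L < 1) (x : E) :
    ∃ p, resolventSet (smulOp η (sumOp F G)) x = {p} := by
  lift η to ℝ≥0 using hη.le
  rw [smulOp_sumOp]
  exact exists_resolventSet_sumOp_eq_singleton (hG.smulOp hη)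
    ((lipschitzWith_smul (η : ℝ)).comp hF) (by simpa [← NNReal.coe_lt_coe] using hηL) x

theorem sum_norm_inexactKM_sub_sq_le (hF : LipschitzWith L F) (hG : IsMaximalMonotoneOp G)
    (hxs : IsWeakMVISolution F G ρ xs) (hη : 0 < η) (hρ : ρ < η) (hηL : η * L < 1) (x₀ : E)
    {p : ℕ → E}
    (hp : ∀ k, p k ∈ resolventSet (smulOp η (sumOp F G)) (inexactKM F G η L ρ x₀ k).val) (n : ℕ) :
    ∑ k ∈ Finset.range n, ((1 - ρ / η) * ‖(inexactKM F G η L ρ x₀ k).val - p k‖) ^ 2 ≤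
      11 * ‖x₀ - xs‖ ^ 2 := by
  let x : ℕ → E := fun k => (inexactKM F G η L ρ x₀ k).val
  let y : ℕ → E := fun k => (approxResolvent F G η L (innerSteps η L k) (x k)).val
  have hα : 0 ≤ 1 - ρ / η := sub_nonneg.2 ((div_lt_one hη).2 hρ).le
  set α := 1 - ρ / η
  have step (k : ℕ) : x (k + 1) = x k - α • (x k - p k) + α • (y k - p k) := by
    change (1 - α) • x k + α • y k = _
    module
  have residual (k : ℕ) : ‖α • (x k - p k)‖ ^ 2 ≤ inner ℝ (α • (x k - p k)) (x k - xs) := by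
    rw [norm_smul, Real.norm_of_nonneg hα, real_inner_smul_left, mul_pow, sq α, mul_assoc]
    exact mul_le_mul_of_nonneg_left (hxs.mul_norm_sq_le_inner hη (hp k)) hα
  have error (k : ℕ) : ‖α • (y k - p k)‖ ^ 2 ≤
      1 / (5 * √((k : ℝ) + 1) ^ 3) * ‖α • (x k - p k)‖ ^ 2 := by
    rw [norm_smul, norm_smul, mul_pow, mul_pow, mul_left_comm]
    gcongr
    exact (norm_approxResolvent_sub_sq_le hF hG hη hηL (hp k) _).trans <| by
      gcongr
      exact pow_innerSteps_le (by positivity) hηL k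
  have sum_le := sum_norm_sq_le_of_inexact_step step residual (fun k => by positivity) error n
  have exp_le : Real.exp (2 * ∑ k ∈ Finset.range n, 1 / (5 * √((k : ℝ) + 1) ^ 3)) ≤ 11 / 2 := by
    refine (Real.exp_le_exp.2 ?_).trans exp_six_fifths_le
    simp only [← one_div_mul_one_div, ← Finset.mul_sum]
    linarith [sum_one_div_sqrt_pow_three_le n]
  simp only [norm_smul, Real.norm_of_nonneg hα] at sum_le
  refine sum_le.trans (mul_le_mul_of_nonneg_right ?_ (sq_nonneg _))
  linarith

theorem exists_norm_inexactKM_sub_le (hF : LipschitzWith L F) (hG : IsMaximalMonotoneOp G)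
    (hxs : IsWeakMVISolution F G ρ xs) (hη : 0 < η) (hρ : ρ < η) (hηL : η * L < 1) {x₀ : E} {ε : ℝ}
    (hε : 0 ≤ ε) {K : ℕ} (hK₀ : K ≠ 0) (hK : 11 * ‖x₀ - xs‖ ^ 2 ≤ K * ((η - ρ) ^ 2 * ε ^ 2)) :
    ∃ k < K, ∃ p, resolventSet (smulOp η (sumOp F G)) (inexactKM F G η L ρ x₀ k).val = {p} ∧
      η⁻¹ * ‖(inexactKM F G η L ρ x₀ k).val - p‖ ≤ ε := by
  choose p hp using fun k => exists_resolventSet_smulOp_sumOp_eq_singleton hF hG hη hηL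
    (inexactKM F G η L ρ x₀ k).val
  have sum_le : ∑ k ∈ Finset.range K, ((1 - ρ / η) * ‖(inexactKM F G η L ρ x₀ k).val - p k‖) ^ 2 ≤
      ∑ _k ∈ Finset.range K, ((η - ρ) * ε) ^ 2 := by
    rw [Finset.sum_const, Finset.card_range, nsmul_eq_mul, mul_pow]
    exact (sum_norm_inexactKM_sub_sq_le hF hG hxs hη hρ hηL x₀
      (fun k => (hp k).symm ▸ Set.mem_singleton (p k)) K).trans hK
  obtain ⟨k, hk, residual_le⟩ :=
    Finset.exists_le_of_sum_le (Finset.nonempty_range_iff.2 hK₀) sum_le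
  refine ⟨k, Finset.mem_range.1 hk, p k, hp k, ?_⟩
  have gap_pos : 0 < η - ρ := sub_pos.2 hρ
  have h := le_of_sq_le_sq residual_le (by positivity)
  rw [one_sub_div hη.ne', div_mul_eq_mul_div, mul_div_assoc] at h
  rw [inv_mul_eq_div]
  exact le_of_mul_le_mul_left h gap_pos

end InexactKM

/-! ### The number of oracle calls -/

theorem calls_inexactKM (F : E → E) (G : E → Set E) (η L ρ : ℝ) (x₀ : E) (K : ℕ) :
    (inexactKM F G η L ρ x₀ K).calls = ∑ k ∈ Finset.range K, 3 * innerSteps η L k := by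
  induction K with
  | zero => rfl
  | succ K ih =>
    rw [Finset.sum_range_succ, ← ih,
      ← calls_approxResolvent F G η L _ (inexactKM F G η L ρ x₀ K).val]
    rfl

theorem log_eight_mul_mul_log_sq_le {Λ : ℝ} (hΛ : 1 ≤ Λ) {k : ℕ} (hk : (k : ℝ) + 1 ≤ 12 * Λ) :
    Real.log (8 * ((k : ℝ) + 1) * Real.log ((k : ℝ) + 2) ^ 2) ≤ 10 * (1 + Real.log Λ) := by
  have arg_pos := (by positivity : 0 < 3 * ((k : ℝ) + 1)).trans_le
    (three_mul_le_eight_mul_mul_log_sq k)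
  have log_nonneg : 0 ≤ Real.log ((k : ℝ) + 2) :=
    Real.log_nonneg (by linarith [k.cast_nonneg (α := ℝ)])
  have log_le : Real.log ((k : ℝ) + 2) ≤ 12 * Λ := by
    linarith [Real.log_le_sub_one_of_pos (show (0 : ℝ) < k + 2 by positivity)]
  calc Real.log (8 * ((k : ℝ) + 1) * Real.log ((k : ℝ) + 2) ^ 2)
      ≤ Real.log (8 * (12 * Λ) * (12 * Λ) ^ 2) := by gcongr
    _ = Real.log (13824 * Λ ^ 3) := by ring_nf
    _ ≤ Real.log (2 ^ 14 * Λ ^ 3) := by gcongr; norm_num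
    _ = 14 * Real.log 2 + 3 * Real.log Λ := by
        rw [Real.log_mul (by positivity) (by positivity), Real.log_pow, Real.log_pow]
        norm_num
    _ ≤ 10 * (1 + Real.log Λ) := by linarith [Real.log_two_lt_d9, Real.log_nonneg hΛ]

theorem innerSteps_le {η L Λ : ℝ} (h₀ : 0 ≤ η * L) (h₁ : η * L < 1) (hΛ : 1 ≤ Λ) {k : ℕ}
    (hk : (k : ℝ) + 1 ≤ 12 * Λ) :
    innerSteps η L k ≤ 41 * ((1 + η * L) / (1 - η * L)) * (1 + Real.log Λ) := by
  have one_le_ratio : 1 ≤ (1 + η * L) / (1 - η * L) := (one_le_div (by linarith)).2 (by linarith)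
  have log_Λ_nonneg := Real.log_nonneg hΛ
  have log_nonneg : 0 ≤ Real.log (8 * ((k : ℝ) + 1) * Real.log ((k : ℝ) + 2) ^ 2) :=
    Real.log_nonneg (by linarith [three_mul_le_eight_mul_mul_log_sq k, k.cast_nonneg (α := ℝ)])
  have log_le := log_eight_mul_mul_log_sq_le hΛ hk
  rw [innerSteps, mul_div_assoc]
  set c := (1 + η * L) / (1 - η * L)
  calc (⌈4 * c * Real.log (8 * ((k : ℝ) + 1) * Real.log ((k : ℝ) + 2) ^ 2)⌉₊ : ℝ)
      ≤ 4 * c * Real.log (8 * ((k : ℝ) + 1) * Real.log ((k : ℝ) + 2) ^ 2) + 1 :=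
        (Nat.ceil_lt_add_one (by positivity)).le
    _ ≤ 4 * c * (10 * (1 + Real.log Λ)) + c * (1 + Real.log Λ) := by
        gcongr
        exact one_le_mul_of_one_le_of_one_le one_le_ratio (by linarith)
    _ = 41 * c * (1 + Real.log Λ) := by ring

theorem calls_inexactKM_le (F : E → E) (G : E → Set E) {η L Λ : ℝ} (ρ : ℝ) (x₀ : E) {K : ℕ}
    (h₀ : 0 ≤ η * L) (h₁ : η * L < 1) (hΛ : 1 ≤ Λ) (hK : (K : ℝ) ≤ 12 * Λ) :
    (inexactKM F G η L ρ x₀ K).calls ≤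
      1476 * ((1 + η * L) / (1 - η * L)) * Λ * (1 + Real.log Λ) := by
  have ratio_nonneg : 0 ≤ (1 + η * L) / (1 - η * L) := div_nonneg (by linarith) (by linarith)
  have log_Λ_nonneg := Real.log_nonneg hΛ
  rw [calls_inexactKM]
  push_cast
  set c := (1 + η * L) / (1 - η * L)
  calc ∑ k ∈ Finset.range K, 3 * (innerSteps η L k : ℝ)
      ≤ ∑ _k ∈ Finset.range K, 3 * (41 * c * (1 + Real.log Λ)) := by
        gcongr with k hk
        have succ_le : (k : ℝ) + 1 ≤ K := by exact_mod_cast Finset.mem_range.1 hk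
        exact innerSteps_le h₀ h₁ hΛ (succ_le.trans hK)
    _ = K * (3 * (41 * c * (1 + Real.log Λ))) := by
        rw [Finset.sum_const, Finset.card_range, nsmul_eq_mul]
    _ ≤ 12 * Λ * (3 * (41 * c * (1 + Real.log Λ))) := by gcongr
    _ = 1476 * c * Λ * (1 + Real.log Λ) := by ring

theorem cast_max_one_ceil_eleven_mul_le {q : ℝ} (hq : 0 ≤ q) :
    ((max 1 ⌈11 * q⌉₊ : ℕ) : ℝ) ≤ 12 * max 1 q := by
  have ceil_lt := Nat.ceil_lt_add_one (by positivity : 0 ≤ 11 * q)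
  have one_le := le_max_left 1 q
  have q_le := le_max_right 1 q
  push_cast
  exact max_le (by linarith) (by linarith)

end WeakMVI

theorem corollary2_general {E : Type*} [NormedAddCommGroup E] [InnerProductSpace ℝ E]
    [CompleteSpace E] {L : ℝ≥0} {η ρ : ℝ} {F : E → E} {G : E → Set E} {x₀ xs : E} {ε : ℝ} {K : ℕ}
    (hF : LipschitzWith L F) (hG : WeakMVI.IsMaximalMonotoneOp G)
    (hxs : WeakMVI.IsWeakMVISolution F G ρ xs) (hη : 0 < η) (hρ : ρ < η) (hηL : η * (L : ℝ) < 1)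
    (hε : 0 < ε) (hK : K = max 1 ⌈11 * ‖x₀ - xs‖ ^ 2 / ((η - ρ) ^ 2 * ε ^ 2)⌉₊) :
    (∃ k < K, ∃ p : E,
      WeakMVI.resolventSet (WeakMVI.smulOp η (WeakMVI.sumOp F G))
        (WeakMVI.inexactKM F G η L ρ x₀ k).val = {p} ∧
      η⁻¹ * ‖(WeakMVI.inexactKM F G η L ρ x₀ k).val - p‖ ≤ ε) ∧
    (WeakMVI.inexactKM F G η L ρ x₀ K).calls ≤
      1476 * ((1 + η * L) / (1 - η * L)) *
        max 1 (‖x₀ - xs‖ ^ 2 / (ε ^ 2 * (η - ρ) ^ 2)) *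
        (1 + Real.log (max 1 (‖x₀ - xs‖ ^ 2 / (ε ^ 2 * (η - ρ) ^ 2)))) := by
  have denominator_pos : 0 < (η - ρ) ^ 2 * ε ^ 2 := by have := sub_pos.2 hρ; positivity
  have ceil_le : ⌈11 * ‖x₀ - xs‖ ^ 2 / ((η - ρ) ^ 2 * ε ^ 2)⌉₊ ≤ K := hK ▸ le_max_right _ _
  have one_le : 1 ≤ K := hK ▸ le_max_left _ _
  constructor
  · exact WeakMVI.exists_norm_inexactKM_sub_le hF hG hxs hη hρ hηL hε.le (by lia)
      ((div_le_iff₀ denominator_pos).1 (Nat.ceil_le.1 ceil_le))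
  · refine WeakMVI.calls_inexactKM_le F G ρ x₀ (by positivity) hηL (le_max_left _ _) ?_
    rw [hK, mul_div_assoc, mul_comm (ε ^ 2)]
    exact WeakMVI.cast_max_one_ceil_eleven_mul_le (by positivity)

theorem corollary2 :
    ∃ C : ℝ, 0 < C ∧
      ∀ (d : ℕ) (L : ℝ≥0) (η ρ : ℝ)
        (F : EuclideanSpace ℝ (Fin d) → EuclideanSpace ℝ (Fin d))
        (G : EuclideanSpace ℝ (Fin d) → Set (EuclideanSpace ℝ (Fin d)))
        (x₀ xs : EuclideanSpace ℝ (Fin d)) (ε : ℝ) (K : ℕ),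
        LipschitzWith L F →
        WeakMVI.IsMaximalMonotoneOp G →
        WeakMVI.IsWeakMVISolution F G ρ xs →
        0 < ρ → ρ < η → η * (L : ℝ) < 1 → 0 < ε →
        K = max 1 ⌈11 * ‖x₀ - xs‖ ^ 2 / ((η - ρ) ^ 2 * ε ^ 2)⌉₊ →
        (∃ k < K, ∃ p : EuclideanSpace ℝ (Fin d),
          WeakMVI.resolventSet (WeakMVI.smulOp η (WeakMVI.sumOp F G))
            (WeakMVI.inexactKM F G η L ρ x₀ k).val = {p} ∧
          η⁻¹ * ‖(WeakMVI.inexactKM F G η L ρ x₀ k).val - p‖ ≤ ε) ∧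
        ((WeakMVI.inexactKM F G η L ρ x₀ K).calls : ℝ) ≤
          C * ((1 + η * L) / (1 - η * L)) *
            max 1 (‖x₀ - xs‖ ^ 2 / (ε ^ 2 * (η - ρ) ^ 2)) *
            (1 + Real.log (max 1 (‖x₀ - xs‖ ^ 2 / (ε ^ 2 * (η - ρ) ^ 2)))) :=
  ⟨1476, by norm_num, fun _ _ _ _ _ _ _ _ _ _ hF hG hxs hρ₀ hρ hηL hε hK =>
    corollary2_general hF hG hxs (hρ₀.trans hρ) hρ hηL hε hK⟩
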